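/- Let $N\ge 0$, let $r_0,\dots,r_N\in\mathbb R$ be pairwise distinct with $r_0=0$, let $\theta\in(0,1)$, and let $F:\mathbb R^{N+1}\to\mathbb R$. Put $E=(1,\dots,1)$, $\Theta=(\theta,\dots,\theta)$ and $f(v)=F(v,\dots,v)$. Assume $(\tilde A_{C^1})$: $F$ is globally Lipschitz continuous, and $C^1$ on a neighborhood in $\mathbb R^{N+1}$ of the two open segments $]0,\Theta[$ and $]\Theta,E[$; $F(X_0,\dots,X_N)$ is non-decreasing with respect to each $X_i$ with $i\neq 0$; and $F(X+E)=F(X)$ for all $X\in\mathbb R^{N+1}$; $(\tilde B_{C^1})$: $f(0)=f(1)$, $f'>0$ on $(0,\theta)$ and $f'<0$ on $(\theta,1)$. Set $\sigma^+=-\min f$ and $\sigma^-=-\max f$. For $\sigma,c,a,b\in\mathbb R$, a traveling wave from $a$ to $b$ with velocity $c$ and driving force $\sigma$ is a non-decreasing function $\phi:\mathbb R\to\mathbb R$ with $\phi(-\infty)=a$ and $\phi(+\infty)=b$ which is a viscosity solution on $\mathbb R$ of $$c\,\phi'(z)=F(\phi(z+r_0),\phi(z+r_1),\dots,\phi(z+r_N))+\sigma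 .$$ Here a viscosity solution is a locally bounded $u:\mathbb R\to\mathbb R$ whose upper semicontinuous envelope $u^*(y)=\limsup_{x\to y}u(x)$ is a subsolution and whose lower semicontinuous envelope $u_*(y)=\liminf_{x\to y}u(x)$ is a supersolution; a locally bounded upper (resp. lower) semicontinuous $w$ is a subsolution (resp. supersolution) if for every $\psi\in C^1(\mathbb R)$ and every point $x$ at which $w-\psi$ has a local maximum (resp. minimum) one has $c\,\psi'(x)\le F(w(x+r_0),\dots,w(x+r_N))+\sigma$ (resp. $\ge$). Then: 1. If $\sigma^+=0$, there exists $c_L>0$ such that for every $c\ge c_L$ there exists a traveling wave from $0$ to $1$ with velocity $c$ and driving force $\sigma=\sigma^+=0$. 2. There exists $c_L'>0$ such that for every $c\le -c_L'$ there exists a traveling wave from $\theta-1$ to $\theta$ with velocity $c$ and driving force $\sigma=\sigma^-$. -/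

import Mathlib

open Filter Topology

noncomputable section

namespace TravelingWave

/-- The restriction `f(v) = F(v, …, v)` of `F` to the diagonal. -/
def diag {N : ℕ} (F : (Fin (N + 1) → ℝ) → ℝ) (v : ℝ) : ℝ := F (fun _ => v)

/-- `F` is globally Lipschitz and of class `C¹` on a neighbourhood of the two open segments
`]0, Θ[` and `]Θ, E[`, where `Θ = (θ, …, θ)` and `E = (1, …, 1)`; it is non-decreasing in each
variable of index `i ≠ 0`, and `1`-periodic in the direction `E`. -/
structure AssumptionA {N : ℕ} (F : (Fin (N + 1) → ℝ) → ℝ) (θ : ℝ) : Prop where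
  lipschitz : ∃ K : NNReal, LipschitzWith K F
  contDiffOn : ∃ U : Set (Fin (N + 1) → ℝ), IsOpen U ∧
    openSegment ℝ (fun _ => (0 : ℝ)) (fun _ => θ) ⊆ U ∧
    openSegment ℝ (fun _ => θ) (fun _ => (1 : ℝ)) ⊆ U ∧
    ContDiffOn ℝ 1 F U
  monotone : ∀ i : Fin (N + 1), i ≠ 0 → ∀ X : Fin (N + 1) → ℝ,
    Monotone fun s : ℝ => F (Function.update X i s)
  periodic : ∀ X : Fin (N + 1) → ℝ, F (fun i => X i + 1) = F X

/-- Bistability of `f(v) = F(v, …, v)`. (A nonzero value of `deriv` includes that `f` is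
differentiable at the point.) -/
structure AssumptionB {N : ℕ} (F : (Fin (N + 1) → ℝ) → ℝ) (θ : ℝ) : Prop where
  eq_endpoints : diag F 0 = diag F 1
  deriv_pos : ∀ v ∈ Set.Ioo 0 θ, 0 < deriv (diag F) v
  deriv_neg : ∀ v ∈ Set.Ioo θ 1, deriv (diag F) v < 0

/-- `σ⁺ = - min f`. (When `f` is continuous and periodic, the infimum is attained.) -/
def sigmaPlus {N : ℕ} (F : (Fin (N + 1) → ℝ) → ℝ) : ℝ := -sInf (Set.range (diag F))

/-- `σ⁻ = - max f`. (When `f` is continuous and periodic, the supremum is attained.) -/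
def sigmaMinus {N : ℕ} (F : (Fin (N + 1) → ℝ) → ℝ) : ℝ := -sSup (Set.range (diag F))

/-- Local boundedness of a real function. -/
def LocallyBounded (u : ℝ → ℝ) : Prop := ∀ x, ∃ C : ℝ, ∀ᶠ y in 𝓝 x, |u y| ≤ C

/-- The upper semicontinuous envelope `u^*(y) = limsup_{x → y} u(x)` of a locally bounded
function. -/
def upperEnvelope (u : ℝ → ℝ) (y : ℝ) : ℝ := limsup u (𝓝 y)

/-- The lower semicontinuous envelope `u_*(y) = liminf_{x → y} u(x)` of a locally bounded
function. -/
def lowerEnvelope (u : ℝ → ℝ) (y : ℝ) : ℝ := liminf u (𝓝 y)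

/-- Viscosity subsolutions on `ℝ` of `c u'(x) = F(u(x + r₀), …, u(x + r_N)) + σ`. -/
structure IsSubsolution {N : ℕ} (F : (Fin (N + 1) → ℝ) → ℝ) (r : Fin (N + 1) → ℝ) (σ c : ℝ)
    (u : ℝ → ℝ) : Prop where
  locallyBounded : LocallyBounded u
  upperSemicontinuous : UpperSemicontinuous u
  test : ∀ ψ : ℝ → ℝ, ContDiff ℝ 1 ψ → ∀ x : ℝ, IsLocalMax (fun y => u y - ψ y) x →
    c * deriv ψ x ≤ F (fun i => u (x + r i)) + σ

/-- Viscosity supersolutions on `ℝ` of `c u'(x) = F(u(x + r₀), …, u(x + r_N)) + σ`. -/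
structure IsSupersolution {N : ℕ} (F : (Fin (N + 1) → ℝ) → ℝ) (r : Fin (N + 1) → ℝ) (σ c : ℝ)
    (u : ℝ → ℝ) : Prop where
  locallyBounded : LocallyBounded u
  lowerSemicontinuous : LowerSemicontinuous u
  test : ∀ ψ : ℝ → ℝ, ContDiff ℝ 1 ψ → ∀ x : ℝ, IsLocalMin (fun y => u y - ψ y) x →
    F (fun i => u (x + r i)) + σ ≤ c * deriv ψ x

/-- (Possibly discontinuous) viscosity solutions on `ℝ` of
`c u'(x) = F(u(x + r₀), …, u(x + r_N)) + σ`. -/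
structure IsViscositySolution {N : ℕ} (F : (Fin (N + 1) → ℝ) → ℝ) (r : Fin (N + 1) → ℝ)
    (σ c : ℝ) (u : ℝ → ℝ) : Prop where
  locallyBounded : LocallyBounded u
  sub : IsSubsolution F r σ c (upperEnvelope u)
  super : IsSupersolution F r σ c (lowerEnvelope u)

/-- `φ` is a (monotone) traveling wave with velocity `c` and driving force `σ`, going from the
state `a` at `-∞` to the state `b` at `+∞`. -/
structure IsTravelingWave {N : ℕ} (F : (Fin (N + 1) → ℝ) → ℝ) (r : Fin (N + 1) → ℝ)
    (σ c a b : ℝ) (φ : ℝ → ℝ) : Prop where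
  solution : IsViscositySolution F r σ c φ
  monotone : Monotone φ
  tendsto_atBot : Tendsto φ atBot (𝓝 a)
  tendsto_atTop : Tendsto φ atTop (𝓝 b)

end TravelingWave

end

open Filter Topology

namespace TravelingWave

/-- Classical solutions of `c u'(t) = F(u(t + r₀), …, u(t + r_N))` growing at most like `e^|t|`. -/
structure IsSlowSolution {N : ℕ} (F : (Fin (N + 1) → ℝ) → ℝ) (r : Fin (N + 1) → ℝ) (c : ℝ)
    (u : ℝ → ℝ) : Prop where
  hasDerivAt : ∀ t, HasDerivAt u (F (fun i => u (t + r i)) / c) t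
  growth : ∃ C : ℝ, ∀ t, |u t| ≤ C * Real.exp |t|

theorem abs_integral_le_of_exp_bound {w : ℝ → ℝ} {D : ℝ}
    (hw : ∀ s, |w s| ≤ D * Real.exp |s|) (t : ℝ) :
    |∫ s in (0 : ℝ)..t, w s| ≤ D * Real.exp |t| := by
  have hD : 0 ≤ D := by
    have := (abs_nonneg _).trans (hw 0)
    simpa using this
  have key : ∀ (w : ℝ → ℝ), (∀ s, |w s| ≤ D * Real.exp |s|) → ∀ t, 0 ≤ t →
      |∫ s in (0 : ℝ)..t, w s| ≤ D * Real.exp |t| := by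
    intro w hw t ht
    have h1 : ‖∫ s in (0 : ℝ)..t, w s‖ ≤ ∫ s in (0 : ℝ)..t, D * Real.exp s := by
      refine intervalIntegral.norm_integral_le_of_norm_le ht ?_ ?_
      · refine Eventually.of_forall fun s hs => ?_
        have := hw s
        rwa [abs_of_pos hs.1] at this
      · exact (by fun_prop : Continuous fun s : ℝ => D * Real.exp s).intervalIntegrable _ _
    rw [intervalIntegral.integral_const_mul, integral_exp, Real.norm_eq_abs, Real.exp_zero] at h1
    rw [abs_of_nonneg ht]
    linarith
  rcases le_total 0 t with ht | ht
  · exact key w hw t ht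
  · have h := key (fun s => w (-s)) (fun s => by simpa using hw (-s)) (-t) (by linarith)
    rw [intervalIntegral.integral_comp_neg, intervalIntegral.integral_symm] at h
    simpa using h

theorem exp_abs_add_le {R x : ℝ} (hx : |x| ≤ R) (s : ℝ) :
    Real.exp |s + x| ≤ Real.exp R * Real.exp |s| := by
  rw [← Real.exp_add]
  exact Real.exp_le_exp.2 (by linarith [abs_add_le s x])

theorem abs_sub_le_of_shifts {N : ℕ} {F : (Fin (N + 1) → ℝ) → ℝ} {r : Fin (N + 1) → ℝ}
    {K : NNReal} {R c D : ℝ} (hF : LipschitzWith K F) (hR : ∀ i, |r i| ≤ R)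
    (hc : 0 < c) (hcK : 2 * K * Real.exp R ≤ c) {u v : ℝ → ℝ}
    (h : ∀ t, |u t - v t| ≤ D * Real.exp |t|) (s : ℝ) :
    |F (fun i => u (s + r i)) / c - F (fun i => v (s + r i)) / c| ≤ D / 2 * Real.exp |s| := by
  have hD : 0 ≤ D := by
    have := (abs_nonneg _).trans (h 0)
    simpa using this
  have h1 : |F (fun i => u (s + r i)) - F (fun i => v (s + r i))|
      ≤ K * (D * (Real.exp R * Real.exp |s|)) := by
    have := hF.dist_le_mul (fun i => u (s + r i)) (fun i => v (s + r i))
    rw [Real.dist_eq] at this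
    refine this.trans (mul_le_mul_of_nonneg_left ?_ K.2)
    refine (dist_pi_le_iff (by positivity)).2 fun i => ?_
    rw [Real.dist_eq]
    exact (h _).trans (mul_le_mul_of_nonneg_left (exp_abs_add_le (hR i) s) hD)
  rw [← sub_div, abs_div, abs_of_pos hc, div_le_iff₀ hc]
  have h2 : 2 * K * Real.exp R * (D / 2 * Real.exp |s|) ≤ c * (D / 2 * Real.exp |s|) :=
    mul_le_mul_of_nonneg_right hcK (by positivity)
  nlinarith [h1, h2]

namespace IsSlowSolution

variable {N : ℕ} {F : (Fin (N + 1) → ℝ) → ℝ} {r : Fin (N + 1) → ℝ} {K : NNReal} {R c : ℝ}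
  {u v : ℝ → ℝ}

theorem continuous (hu : IsSlowSolution F r c u) : Continuous u :=
  continuous_iff_continuousAt.2 fun t => (hu.hasDerivAt t).continuousAt

theorem continuous_rhs (hu : IsSlowSolution F r c u) (hF : Continuous F) :
    Continuous fun t => F (fun i => u (t + r i)) / c := by
  have := hu.continuous
  fun_prop

theorem const {p : ℝ} (hp : diag F p = 0) : IsSlowSolution F r c fun _ => p where
  hasDerivAt t := by
    have : F (fun _ => p) = 0 := hp
    simpa [this] using hasDerivAt_const t p
  growth := ⟨|p|, fun t => le_mul_of_one_le_right (abs_nonneg _) (Real.one_le_exp (abs_nonneg _))⟩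

theorem comp_add (hu : IsSlowSolution F r c u) (h : ℝ) :
    IsSlowSolution F r c fun t => u (t + h) where
  hasDerivAt t := by
    have := (hu.hasDerivAt (t + h)).comp_add_const t h
    simpa only [add_right_comm] using this
  growth := by
    obtain ⟨C, hC⟩ := hu.growth
    have hC0 : 0 ≤ C := by
      have := (abs_nonneg _).trans (hC 0)
      simpa using this
    refine ⟨C * Real.exp |h|, fun t => (hC _).trans ?_⟩
    rw [mul_assoc]
    exact mul_le_mul_of_nonneg_left (exp_abs_add_le le_rfl t) hC0

theorem abs_sub_le_zero (hu : IsSlowSolution F r c u) (hv : IsSlowSolution F r c v)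
    (hF : LipschitzWith K F) (hR : ∀ i, |r i| ≤ R) (hc : 0 < c)
    (hcK : 2 * K * Real.exp R ≤ c) (t : ℝ) :
    |u t - v t| ≤ 2 * |u 0 - v 0| * Real.exp |t| := by
  obtain ⟨A, hA⟩ := hu.growth
  obtain ⟨B, hB⟩ := hv.growth
  have hbdd : BddAbove (Set.range fun t => |u t - v t| / Real.exp |t|) := by
    refine ⟨A + B, ?_⟩
    rintro _ ⟨t, rfl⟩
    rw [div_le_iff₀ (Real.exp_pos _)]
    linarith [abs_sub (u t) (v t), hA t, hB t]
  set D := ⨆ t, |u t - v t| / Real.exp |t| with hD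
  have h1 : ∀ t, |u t - v t| ≤ D * Real.exp |t| := fun t => by
    rw [← div_le_iff₀ (Real.exp_pos _)]
    exact le_ciSup hbdd t
  have h2 : ∀ t, |u t - v t| ≤ (|u 0 - v 0| + D / 2) * Real.exp |t| := by
    intro t
    have hint := abs_integral_le_of_exp_bound
      (abs_sub_le_of_shifts hF hR hc hcK h1) t
    have hFTC := intervalIntegral.integral_eq_sub_of_hasDerivAt (a := 0) (b := t)
      (fun s _ => (hu.hasDerivAt s).sub (hv.hasDerivAt s))
      (((hu.continuous_rhs hF.continuous).sub
        (hv.continuous_rhs hF.continuous)).intervalIntegrable _ _)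
    rw [hFTC] at hint
    simp only [Pi.sub_apply] at hint
    have h3 : |u 0 - v 0| ≤ |u 0 - v 0| * Real.exp |t| :=
      le_mul_of_one_le_right (abs_nonneg _) (Real.one_le_exp (abs_nonneg _))
    have h4 := abs_add_le (u t - v t - (u 0 - v 0)) (u 0 - v 0)
    rw [sub_add_cancel] at h4
    linarith
  have h3 : D ≤ |u 0 - v 0| + D / 2 :=
    ciSup_le fun t => (div_le_iff₀ (Real.exp_pos _)).2 (h2 t)
  exact (h1 t).trans (mul_le_mul_of_nonneg_right (by linarith) (Real.exp_pos _).le)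

/-- Continuous dependence of slow solutions on their value at one point. -/
theorem abs_sub_le (hu : IsSlowSolution F r c u) (hv : IsSlowSolution F r c v)
    (hF : LipschitzWith K F) (hR : ∀ i, |r i| ≤ R) (hc : 0 < c)
    (hcK : 2 * K * Real.exp R ≤ c) (s t : ℝ) :
    |u t - v t| ≤ 2 * |u s - v s| * Real.exp |t - s| := by
  simpa using (hu.comp_add s).abs_sub_le_zero (hv.comp_add s) hF hR hc hcK (t - s)

theorem eq_of_eq (hu : IsSlowSolution F r c u) (hv : IsSlowSolution F r c v)
    (hF : LipschitzWith K F) (hR : ∀ i, |r i| ≤ R) (hc : 0 < c)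
    (hcK : 2 * K * Real.exp R ≤ c) {s : ℝ} (h : u s = v s) (t : ℝ) : u t = v t := by
  have := hu.abs_sub_le hv hF hR hc hcK s t
  rw [h, sub_self, abs_zero, mul_zero, zero_mul] at this
  exact sub_eq_zero.1 (abs_nonpos_iff.1 this)

/-- A slow solution with a critical point is constant. -/
theorem diag_eq_zero_of_critical (hu : IsSlowSolution F r c u)
    (hF : LipschitzWith K F) (hR : ∀ i, |r i| ≤ R) (hc : 0 < c)
    (hcK : 2 * K * Real.exp R ≤ c) {s : ℝ} (h : F (fun i => u (s + r i)) = 0) (t : ℝ) :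
    diag F (u t) = 0 := by
  have h0 : HasDerivAt u 0 s := by simpa [h] using hu.hasDerivAt s
  have hd : ∀ t, HasDerivAt u 0 t := by
    intro t
    rw [hasDerivAt_iff_isLittleO_nhds_zero] at h0 ⊢
    simp only [smul_zero, sub_zero] at h0 ⊢
    refine Asymptotics.IsBigO.trans_isLittleO ?_ h0
    refine Asymptotics.IsBigO.of_bound (2 * Real.exp |t - s|) (Eventually.of_forall fun k => ?_)
    have := (hu.comp_add k).abs_sub_le hu hF hR hc hcK s t
    simp only [Real.norm_eq_abs]
    linarith
  have hconst : ∀ x y, u x = u y :=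
    is_const_of_deriv_eq_zero (fun t => (hd t).differentiableAt) fun t => (hd t).deriv
  have h1 := (hu.hasDerivAt t).unique (hd t)
  have h2 : (fun i => u (t + r i)) = fun _ => u t := funext fun i => hconst _ _
  rw [h2, div_eq_zero_iff] at h1
  exact h1.resolve_right hc.ne'

end IsSlowSolution

/-- Global existence of a slow solution with prescribed value at `0`, for a large velocity. -/
theorem exists_isSlowSolution {N : ℕ} {F : (Fin (N + 1) → ℝ) → ℝ} {r : Fin (N + 1) → ℝ}
    {K : NNReal} {R c : ℝ} (hF : LipschitzWith K F) (hR : ∀ i, |r i| ≤ R) (hc : 0 < c)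
    (hcK : 2 * K * Real.exp R ≤ c) (p : ℝ) :
    ∃ u, IsSlowSolution F r c u ∧ u 0 = p := by
  let L : BoundedContinuousFunction ℝ ℝ → ℝ → ℝ := fun w t => Real.exp |t| * w t
  let g : BoundedContinuousFunction ℝ ℝ → ℝ → ℝ := fun w s => F (fun i => L w (s + r i)) / c
  have hFc := hF.continuous
  have hL : ∀ w, Continuous (L w) := fun w => by
    have := w.continuous
    fun_prop
  have hg : ∀ w, Continuous (g w) := fun w => by
    have := hL w
    fun_prop
  have hLsub : ∀ v w t, |L v t - L w t| ≤ dist v w * Real.exp |t| := fun v w t => by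
    have h := BoundedContinuousFunction.dist_coe_le_dist (f := v) (g := w) t
    rw [Real.dist_eq] at h
    rw [← mul_sub, abs_mul, Real.abs_exp, mul_comm]
    exact mul_le_mul_of_nonneg_right h (Real.exp_pos _).le
  have hgsub : ∀ v w s, |g v s - g w s| ≤ dist v w / 2 * Real.exp |s| := fun v w =>
    abs_sub_le_of_shifts hF hR hc hcK (hLsub v w)
  have hone : ∀ t : ℝ, 1 ≤ Real.exp |t| := fun t => Real.one_le_exp (abs_nonneg _)
  have hgbd : ∀ w s, |g w s| ≤ (dist w 0 / 2 + |F 0 / c|) * Real.exp |s| := fun w s => by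
    have h1 := hgsub w 0 s
    have h2 : g 0 s = F 0 / c := by
      have : (fun i => L 0 (s + r i)) = 0 := funext fun i => by simp [L]
      simp only [g, this]
    rw [h2] at h1
    have h3 := abs_add_le (g w s - F 0 / c) (F 0 / c)
    rw [sub_add_cancel] at h3
    have h4 := le_mul_of_one_le_right (abs_nonneg (F 0 / c)) (hone s)
    linarith
  let T : BoundedContinuousFunction ℝ ℝ → BoundedContinuousFunction ℝ ℝ := fun w =>
    BoundedContinuousFunction.ofNormedAddCommGroup
      (fun t => Real.exp (-|t|) * (p + ∫ s in (0 : ℝ)..t, g w s))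
      (by
        have : Continuous fun t => ∫ s in (0 : ℝ)..t, g w s :=
          intervalIntegral.continuous_primitive (fun a b => (hg w).intervalIntegrable a b) 0
        fun_prop)
      (|p| + (dist w 0 / 2 + |F 0 / c|))
      (fun t => by
        have h1 := abs_integral_le_of_exp_bound (hgbd w) t
        have h2 := le_mul_of_one_le_right (abs_nonneg p) (hone t)
        have h3 := abs_add_le p (∫ s in (0 : ℝ)..t, g w s)
        rw [Real.norm_eq_abs, abs_mul, Real.abs_exp, Real.exp_neg, inv_mul_le_iff₀ (Real.exp_pos _)]
        linarith)
  have hT : ∀ w t, T w t = Real.exp (-|t|) * (p + ∫ s in (0 : ℝ)..t, g w s) := fun w t => rfl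
  have hcontr : ContractingWith (1 / 2) T := by
    refine ⟨by norm_num, LipschitzWith.of_dist_le_mul fun v w => ?_⟩
    refine (BoundedContinuousFunction.dist_le (by positivity)).2 fun t => ?_
    have h1 := abs_integral_le_of_exp_bound (hgsub v w) t
    rw [intervalIntegral.integral_sub ((hg v).intervalIntegrable _ _)
      ((hg w).intervalIntegrable _ _)] at h1
    rw [Real.dist_eq, hT, hT, ← mul_sub, abs_mul, Real.abs_exp, Real.exp_neg,
      inv_mul_le_iff₀ (Real.exp_pos _), add_sub_add_left_eq_sub]
    push_cast
    linarith
  obtain ⟨w, hw⟩ : ∃ w, T w = w := ⟨_, hcontr.fixedPoint_isFixedPt⟩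
  have hLw : ∀ t, L w t = p + ∫ s in (0 : ℝ)..t, g w s := fun t => by
    have h1 := hT w t
    rw [hw] at h1
    simp only [L]
    rw [h1, ← mul_assoc, ← Real.exp_add, add_neg_cancel, Real.exp_zero, one_mul]
  refine ⟨L w, ⟨fun t => ?_, ‖w‖, fun t => ?_⟩, ?_⟩
  · have h1 := ((hg w).integral_hasStrictDerivAt 0 t).hasDerivAt.const_add p
    exact h1.congr_of_eventuallyEq (Eventually.of_forall hLw)
  · simp only [L]
    rw [abs_mul, Real.abs_exp, mul_comm]
    exact mul_le_mul_of_nonneg_right (w.norm_coe_le_norm t) (Real.exp_pos _).le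
  · rw [hLw, intervalIntegral.integral_same, add_zero]

/-- The limit of a slow solution is a zero of the diagonal. -/
theorem IsSlowSolution.diag_eq_zero_of_tendsto {N : ℕ} {F : (Fin (N + 1) → ℝ) → ℝ}
    {r : Fin (N + 1) → ℝ} {c : ℝ} {u : ℝ → ℝ} (hu : IsSlowSolution F r c u) (hF : Continuous F)
    (hc : 0 < c) {l : Filter ℝ} [l.NeBot] {p : ℝ} (hl : Tendsto u l (𝓝 p))
    (hadd : ∀ y : ℝ, Tendsto (fun x => x + y) l l)
    (hbetween : ∀ ξ : ℝ → ℝ, (∀ x, ξ x ∈ Set.Ioo x (x + 1)) → Tendsto ξ l l) :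
    diag F p = 0 := by
  have hmvt : ∀ x : ℝ, ∃ ξ ∈ Set.Ioo x (x + 1),
      F (fun i => u (ξ + r i)) / c = (u (x + 1) - u x) / (x + 1 - x) := fun x =>
    exists_hasDerivAt_eq_slope u _ (by linarith) hu.continuous.continuousOn
      fun y _ => hu.hasDerivAt y
  choose ξ hξ hξ' using hmvt
  have h1 : Tendsto (fun x => F (fun i => u (x + r i)) / c) l (𝓝 (F (fun _ => p) / c)) :=
    ((hF.tendsto _).comp (tendsto_pi_nhds.2 fun i => hl.comp (hadd (r i)))).div_const c
  have h2 := h1.comp (hbetween ξ hξ)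
  have h3 : Tendsto (fun x => u (x + 1) - u x) l (𝓝 (p - p)) := (hl.comp (hadd 1)).sub hl
  have h4 : F (fun _ => p) / c = p - p := by
    refine tendsto_nhds_unique h2 (h3.congr fun x => ?_)
    simp [hξ']
  rw [sub_self, div_eq_zero_iff] at h4
  exact h4.resolve_right hc.ne'

/-- A positive reaction term between two zeros produces an increasing heteroclinic solution for
every sufficiently large velocity. -/
theorem exists_monotone_solution {N : ℕ} {F : (Fin (N + 1) → ℝ) → ℝ} (r : Fin (N + 1) → ℝ)
    {K : NNReal} (hF : LipschitzWith K F) {a b : ℝ} (hab : a < b) (ha : diag F a = 0)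
    (hb : diag F b = 0) (hpos : ∀ v ∈ Set.Ioo a b, 0 < diag F v) :
    ∃ c₀ : ℝ, 0 < c₀ ∧ ∀ c, c₀ ≤ c → ∃ u : ℝ → ℝ,
      (∀ t, HasDerivAt u (F (fun i => u (t + r i)) / c) t) ∧ Monotone u ∧
      Tendsto u atBot (𝓝 a) ∧ Tendsto u atTop (𝓝 b) := by
  obtain ⟨R, hR0, hR⟩ : ∃ R : ℝ, 0 ≤ R ∧ ∀ i, |r i| ≤ R :=
    ⟨‖r‖, norm_nonneg _, fun i => norm_le_pi_norm r i⟩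
  set m := (a + b) / 2 with hm
  have hmI : m ∈ Set.Ioo a b := ⟨by linarith, by linarith⟩
  have hfm := hpos m hmI
  have hK0 : (0 : ℝ) ≤ K := K.2
  refine ⟨2 * K * Real.exp R + K * (K * (b - a) * R) / diag F m + 1, ?_, fun c hc => ?_⟩
  · have : 0 ≤ b - a := by linarith
    positivity
  have hba : 0 ≤ b - a := by linarith
  have hq : 0 ≤ K * (K * (b - a) * R) / diag F m := by positivity
  have hq' : 0 ≤ 2 * K * Real.exp R := by positivity
  have hc0 : 0 < c := by linarith
  have hcK : 2 * K * Real.exp R ≤ c := by linarith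
  have hcm : K * (K * (b - a) * R) / c < diag F m := by
    rw [div_lt_iff₀ hc0]
    have : K * (K * (b - a) * R) / diag F m < c := by linarith
    rw [div_lt_iff₀ hfm] at this
    linarith
  obtain ⟨u, hu, hu0⟩ := exists_isSlowSolution hF hR hc0 hcK m
  have hne : ∀ q, diag F q = 0 → ∀ t, u t ≠ q := fun q hq t h => by
    have h0 := hu.eq_of_eq (.const hq) hF hR hc0 hcK h 0
    rw [← h0, hu0] at hq
    exact hfm.ne' hq
  have hau : ∀ t, a < u t := fun t => by
    by_contra! h
    obtain ⟨s, hs⟩ := mem_range_of_exists_le_of_exists_ge hu.continuous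
      ⟨t, h⟩ ⟨0, by rw [hu0]; exact hmI.1.le⟩
    exact hne a ha s hs
  have hub : ∀ t, u t < b := fun t => by
    by_contra! h
    obtain ⟨s, hs⟩ := mem_range_of_exists_le_of_exists_ge hu.continuous
      ⟨0, by rw [hu0]; exact hmI.2.le⟩ ⟨t, h⟩
    exact hne b hb s hs
  have hFne : ∀ t, F (fun i => u (t + r i)) ≠ 0 := fun t h => by
    have := hu.diag_eq_zero_of_critical hF hR hc0 hcK h 0
    rw [hu0] at this
    exact hfm.ne' this
  have hderiv : ∀ t, ‖F (fun i => u (t + r i)) / c‖ ≤ K * (b - a) / c := fun t => by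
    rw [norm_div, Real.norm_eq_abs, Real.norm_eq_abs, abs_of_pos hc0]
    gcongr
    have h1 := hF.dist_le_mul (fun i => u (t + r i)) (fun _ => a)
    rw [Real.dist_eq, show F (fun _ => a) = 0 from ha, sub_zero] at h1
    refine h1.trans (mul_le_mul_of_nonneg_left ?_ hK0)
    refine (dist_pi_le_iff hba).2 fun i => ?_
    rw [Real.dist_eq, abs_of_pos (by linarith [hau (t + r i)])]
    linarith [hub (t + r i)]
  have hF0 : 0 < F (fun i => u (0 + r i)) := by
    have h1 := hF.dist_le_mul (fun i => u (0 + r i)) (fun _ => m)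
    have h2 : dist (fun i => u (0 + r i)) (fun _ => m) ≤ K * (b - a) / c * R := by
      refine (dist_pi_le_iff (by positivity)).2 fun i => ?_
      have h3 := convex_univ.norm_image_sub_le_of_norm_hasDerivWithin_le
        (fun t _ => (hu.hasDerivAt t).hasDerivWithinAt) (fun t _ => hderiv t)
        (Set.mem_univ 0) (Set.mem_univ (0 + r i))
      rw [hu0, zero_add, sub_zero, Real.norm_eq_abs (r i)] at h3
      rw [zero_add, dist_eq_norm]
      exact h3.trans (mul_le_mul_of_nonneg_left (hR i) (by positivity))
    have h4 := h1.trans (mul_le_mul_of_nonneg_left h2 hK0)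
    rw [show (K : ℝ) * (K * (b - a) / c * R) = K * (K * (b - a) * R) / c by ring,
      Real.dist_eq] at h4
    have h5 := (abs_le.1 h4).1
    have h6 : F (fun _ => m) = diag F m := rfl
    linarith
  have hFpos : ∀ t, 0 < F (fun i => u (t + r i)) := fun t => by
    by_contra! h
    have hcont : Continuous fun t => F (fun i => u (t + r i)) := by
      have := hu.continuous
      have := hF.continuous
      fun_prop
    obtain ⟨s, hs⟩ := mem_range_of_exists_le_of_exists_ge hcont ⟨t, h⟩ ⟨0, hF0.le⟩
    exact hFne s hs
  have hmono : Monotone u := monotone_of_hasDerivAt_nonneg hu.hasDerivAt fun t =>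
    (div_pos (hFpos t) hc0).le
  have hbb : BddBelow (Set.range u) := ⟨a, by rintro _ ⟨t, rfl⟩; exact (hau t).le⟩
  have hba' : BddAbove (Set.range u) := ⟨b, by rintro _ ⟨t, rfl⟩; exact (hub t).le⟩
  have hbot := tendsto_atBot_ciInf hmono hbb
  have htop := tendsto_atTop_ciSup hmono hba'
  have hzbot := hu.diag_eq_zero_of_tendsto hF.continuous hc0 hbot
    (fun y => tendsto_atBot_add_const_right _ y tendsto_id)
    (fun ξ hξ => tendsto_atBot_mono (fun x => (hξ x).2.le)
      (tendsto_atBot_add_const_right _ 1 tendsto_id))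
  have hztop := hu.diag_eq_zero_of_tendsto hF.continuous hc0 htop
    (fun y => tendsto_atTop_add_const_right _ y tendsto_id)
    (fun ξ hξ => tendsto_atTop_mono (fun x => (hξ x).1.le) tendsto_id)
  have hinf : (⨅ t, u t) = a := by
    have h1 : a ≤ ⨅ t, u t := le_ciInf fun t => (hau t).le
    have h2 : (⨅ t, u t) ≤ m := hu0 ▸ ciInf_le hbb 0
    rcases h1.eq_or_lt with h | h
    · exact h.symm
    · exact absurd hzbot (hpos _ ⟨h, h2.trans_lt hmI.2⟩).ne'
  have hsup : (⨆ t, u t) = b := by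
    have h1 : (⨆ t, u t) ≤ b := ciSup_le fun t => (hub t).le
    have h2 : m ≤ ⨆ t, u t := hu0 ▸ le_ciSup hba' 0
    rcases h1.eq_or_lt with h | h
    · exact h
    · exact absurd hztop (hpos _ ⟨hmI.1.trans_le h2, h⟩).ne'
  exact ⟨u, hu.hasDerivAt, hmono, hinf ▸ hbot, hsup ▸ htop⟩

/-- Classical solutions are viscosity solutions. -/
theorem isViscositySolution_of_hasDerivAt {N : ℕ} {F : (Fin (N + 1) → ℝ) → ℝ}
    {r : Fin (N + 1) → ℝ} {σ c : ℝ} {u u' : ℝ → ℝ} (hu : ∀ t, HasDerivAt u (u' t) t)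
    (heq : ∀ t, c * u' t = F (fun i => u (t + r i)) + σ) : IsViscositySolution F r σ c u := by
  have hcont : Continuous u := continuous_iff_continuousAt.2 fun t => (hu t).continuousAt
  have hup : upperEnvelope u = u := funext fun y => (hcont.tendsto y).limsup_eq
  have hlow : lowerEnvelope u = u := funext fun y => (hcont.tendsto y).liminf_eq
  have hloc : LocallyBounded u := fun x => ⟨|u x| + 1,
    (hcont.abs.tendsto x).eventually_le_const (lt_add_one _)⟩
  have htest : ∀ ψ : ℝ → ℝ, ContDiff ℝ 1 ψ → ∀ x : ℝ, IsLocalExtr (fun y => u y - ψ y) x →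
      c * deriv ψ x = F (fun i => u (x + r i)) + σ := by
    intro ψ hψ x hx
    have hd := (hu x).sub ((hψ.differentiable one_ne_zero) x).hasDerivAt
    have h0 := hx.hasDerivAt_eq_zero hd
    rw [← heq, sub_eq_zero.1 h0]
  refine ⟨hloc, ?_, ?_⟩
  · rw [hup]
    exact ⟨hloc, hcont.upperSemicontinuous, fun ψ hψ x hx => (htest ψ hψ x (.inr hx)).le⟩
  · rw [hlow]
    exact ⟨hloc, hcont.lowerSemicontinuous, fun ψ hψ x hx => (htest ψ hψ x (.inl hx)).ge⟩

section Diagonal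

variable {N : ℕ} {F : (Fin (N + 1) → ℝ) → ℝ} {θ : ℝ}

theorem AssumptionA.continuous_diag (hA : AssumptionA F θ) : Continuous (diag F) := by
  obtain ⟨K, hK⟩ := hA.lipschitz
  exact hK.continuous.comp (continuous_pi fun _ => continuous_id)

theorem AssumptionA.diag_periodic (hA : AssumptionA F θ) : Function.Periodic (diag F) 1 :=
  fun v => hA.periodic fun _ => v

theorem AssumptionB.strictMonoOn (hB : AssumptionB F θ) (hA : AssumptionA F θ) :
    StrictMonoOn (diag F) (Set.Icc 0 θ) :=
  strictMonoOn_of_deriv_pos (convex_Icc _ _) hA.continuous_diag.continuousOn fun v hv =>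
    hB.deriv_pos v (by rwa [interior_Icc] at hv)

theorem AssumptionB.strictAntiOn (hB : AssumptionB F θ) (hA : AssumptionA F θ) :
    StrictAntiOn (diag F) (Set.Icc θ 1) :=
  strictAntiOn_of_deriv_neg (convex_Icc _ _) hA.continuous_diag.continuousOn fun v hv =>
    hB.deriv_neg v (by rwa [interior_Icc] at hv)

theorem AssumptionB.diag_zero_lt (hB : AssumptionB F θ) (hA : AssumptionA F θ)
    (hθ : θ ∈ Set.Ioo (0 : ℝ) 1) {v : ℝ} (hv : v ∈ Set.Ioo (0 : ℝ) 1) :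
    diag F 0 < diag F v := by
  rcases le_total v θ with h | h
  · exact hB.strictMonoOn hA ⟨le_rfl, hθ.1.le⟩ ⟨hv.1.le, h⟩ hv.1
  · rw [hB.eq_endpoints]
    exact hB.strictAntiOn hA ⟨h, hv.2.le⟩ ⟨hθ.2.le, le_rfl⟩ hv.2

theorem AssumptionB.diag_lt (hB : AssumptionB F θ) (hA : AssumptionA F θ)
    (hθ : θ ∈ Set.Ioo (0 : ℝ) 1) {v : ℝ} (hv : v ∈ Set.Ioo (θ - 1) θ) :
    diag F v < diag F θ := by
  rcases le_total 0 v with h | h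
  · exact hB.strictMonoOn hA ⟨h, hv.2.le⟩ ⟨hθ.1.le, le_rfl⟩ hv.2
  · rw [← hA.diag_periodic v]
    exact hB.strictAntiOn hA ⟨le_rfl, hθ.2.le⟩ ⟨by linarith [hv.1], by linarith⟩
      (by linarith [hv.1])

theorem AssumptionB.sigmaPlus_eq (hB : AssumptionB F θ) (hA : AssumptionA F θ)
    (hθ : θ ∈ Set.Ioo (0 : ℝ) 1) : sigmaPlus F = -diag F 0 := by
  refine congrArg Neg.neg (IsLeast.csInf_eq ⟨⟨0, rfl⟩, ?_⟩)
  rintro _ ⟨v, rfl⟩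
  obtain ⟨w, hw, hvw⟩ := hA.diag_periodic.exists_mem_Ico₀ one_pos v
  rw [hvw]
  rcases hw.1.eq_or_lt with h | h
  · rw [← h]
  · exact (hB.diag_zero_lt hA hθ ⟨h, hw.2⟩).le

theorem AssumptionB.sigmaMinus_eq (hB : AssumptionB F θ) (hA : AssumptionA F θ)
    (hθ : θ ∈ Set.Ioo (0 : ℝ) 1) : sigmaMinus F = -diag F θ := by
  refine congrArg Neg.neg (IsGreatest.csSup_eq ⟨⟨θ, rfl⟩, ?_⟩)
  rintro _ ⟨v, rfl⟩
  obtain ⟨w, hw, hvw⟩ := hA.diag_periodic.exists_mem_Ioc one_pos v (θ - 1)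
  rw [sub_add_cancel] at hw
  rw [hvw]
  rcases hw.2.eq_or_lt with h | h
  · rw [h]
  · exact (hB.diag_lt hA hθ ⟨hw.1, h⟩).le

end Diagonal

end TravelingWave

theorem proposition3p4 {N : ℕ} (F : (Fin (N + 1) → ℝ) → ℝ) (r : Fin (N + 1) → ℝ) (θ : ℝ)
    (hr0 : r 0 = 0) (hr : Function.Injective r) (hθ : θ ∈ Set.Ioo (0 : ℝ) 1)
    (hA : TravelingWave.AssumptionA F θ) (hB : TravelingWave.AssumptionB F θ) :
    (TravelingWave.sigmaPlus F = 0 →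
      ∃ cL : ℝ, 0 < cL ∧ ∀ c : ℝ, cL ≤ c →
        ∃ φ : ℝ → ℝ, TravelingWave.IsTravelingWave F r 0 c 0 1 φ) ∧
    (∃ cL' : ℝ, 0 < cL' ∧ ∀ c : ℝ, c ≤ -cL' →
      ∃ φ : ℝ → ℝ, TravelingWave.IsTravelingWave F r (TravelingWave.sigmaMinus F) c
        (θ - 1) θ φ) := by
  obtain ⟨K, hK⟩ := hA.lipschitz
  constructor
  · intro hσ
    rw [hB.sigmaPlus_eq hA hθ, neg_eq_zero] at hσ
    obtain ⟨c₀, hc₀, h⟩ := TravelingWave.exists_monotone_solution r hK zero_lt_one hσ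
      (hB.eq_endpoints ▸ hσ) fun v hv => hσ ▸ hB.diag_zero_lt hA hθ hv
    refine ⟨c₀, hc₀, fun c hc => ?_⟩
    obtain ⟨u, hu, hmono, hbot, htop⟩ := h c hc
    refine ⟨u, TravelingWave.isViscositySolution_of_hasDerivAt hu fun t => ?_, hmono, hbot, htop⟩
    rw [mul_div_cancel₀ _ (hc₀.trans_le hc).ne', add_zero]
  · rw [hB.sigmaMinus_eq hA hθ]
    set M := TravelingWave.diag F θ with hM
    have hG : LipschitzWith K fun X => M - F X :=
      LipschitzWith.of_dist_le_mul fun X Y => by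
        rw [dist_sub_left]
        exact hK.dist_le_mul X Y
    have hdiag : ∀ v, TravelingWave.diag (fun X => M - F X) v = M - TravelingWave.diag F v :=
      fun v => rfl
    have hθ1 : TravelingWave.diag F (θ - 1) = M := by
      rw [← hA.diag_periodic (θ - 1), sub_add_cancel]
    obtain ⟨c₀, hc₀, h⟩ := TravelingWave.exists_monotone_solution r hG (sub_one_lt θ)
      (by rw [hdiag, hθ1, sub_self]) (by rw [hdiag, sub_self])
      fun v hv => by rw [hdiag]; exact sub_pos.2 (hB.diag_lt hA hθ hv)
    refine ⟨c₀, hc₀, fun c hc => ?_⟩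
    obtain ⟨u, hu, hmono, hbot, htop⟩ := h (-c) (by linarith)
    refine ⟨u, TravelingWave.isViscositySolution_of_hasDerivAt hu fun t => ?_, hmono, hbot, htop⟩
    have hc0 : c ≠ 0 := by linarith
    field_simp
    ring
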